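/- Let $\mathbb N=\{1,2,3,\dots\}$; Banach spaces are real. A filter on $\mathbb N$ is called free if it is proper and contains every cofinite subset of $\mathbb N$. For a free filter $\mathfrak F$ on $\mathbb N$, a sequence $(u_k)_{k\in\mathbb N}$ in a Banach space $X$ is an $\mathfrak F$-basis of $X$ if for every $x\in X$ there is a unique sequence of scalars $(c_k)=(u_k^*(x))$ such that the partial sums $\sum_{k=1}^n c_k u_k$ converge in norm to $x$ with respect to $\mathfrak F$, i.e. $\{n:\|x-\sum_{k=1}^n c_ku_k\|<\varepsilon\}\in\mathfrak F$ for every $\varepsilon>0$. Its partial sum operators are the linear maps $S_n\colon X\to X$, $S_n(x)=\sum_{k=1}^n u_k^*(x)u_k$; a statement "$\|S_n\|=a_n$ for all $n$" includes the claim that all $S_n$ are continuous (equivalently, that all coordinate functionals $u_k^*$ are continuous). For a sequence $s=(s_k)$ of non-negative reals with $\sum_k s_k=\infty$, the summable filter is $\mathfrak F^s=\{A\subset\mathbb N:\sum_{k\in\mathbb N\setminus A}s_k<\infty\}$. **Theorem.** Let $(a_n)_{n\in\mathbb N}$ be a sequence of real numbers in $(1,\infty)$. The following conditions are equivalent: (i)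 $\sum_{n\in\mathbb N}a_n^{-1}=\infty$. (ii) There are a free filter $\mathfrak F$ on $\mathbb N$, an infinite-dimensional Banach space $X$ and an $\mathfrak F$-basis $(u_k)_{k\in\mathbb N}$ of $X$ whose partial sum operators satisfy $\|S_n\|=a_n$ for all $n\in\mathbb N$. (iii) For $s=(a_n^{-1})_{n\in\mathbb N}$, the family $\mathfrak F^s=\{A\subset\mathbb N:\sum_{k\in\mathbb N\setminus A}s_k<\infty\}$ is a free filter, and there is an $\mathfrak F^s$-basis of $\ell_1$ whose partial sum operators satisfy $\|S_n\|=a_n$ for all $n\in\mathbb N$. -/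

import Mathlib

universe u

open Filter Topology

/-- The index set `{1, 2, 3, …}` is represented by `ℕ`, the index `n : ℕ` standing for `n + 1`.
A filter on `ℕ` is free if it is proper and contains all cofinite sets. -/
structure IsFreeFilter (F : Filter ℕ) : Prop where
  neBot : F.NeBot
  le_cofinite : F ≤ Filter.cofinite

/-- The partial sum of `∑ c k • e k` with index `n`, that is, over the indices `0, …, n`. -/
def seriesPartialSum {X : Type*} [NormedAddCommGroup X] [NormedSpace ℝ X]
    (e : ℕ → X) (c : ℕ → ℝ) (n : ℕ) : X :=
  ∑ k ∈ Finset.range (n + 1), c k • e k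

/-- `e` is an `F`-basis of `X`: `F` is a free filter, and each `x` has a unique
expansion whose partial sums converge to `x` with respect to `F`. -/
structure IsFilterBasis {X : Type*} [NormedAddCommGroup X] [NormedSpace ℝ X]
    (F : Filter ℕ) (e : ℕ → X) : Prop where
  free : IsFreeFilter F
  existsUnique : ∀ x : X, ∃! c : ℕ → ℝ, Tendsto (seriesPartialSum e c) F (𝓝 x)

namespace IsFilterBasis

/-- The `k`-th coordinate of `x` with respect to the `F`-basis `e`. -/
noncomputable def coord {X : Type*} [NormedAddCommGroup X] [NormedSpace ℝ X]
    {F : Filter ℕ} {e : ℕ → X} (h : IsFilterBasis F e) (k : ℕ) (x : X) : ℝ :=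
  (h.existsUnique x).choose k

/-- The partial sum map `S_n : X → X` of the `F`-basis `e`. -/
noncomputable def partialSumMap {X : Type*} [NormedAddCommGroup X] [NormedSpace ℝ X]
    {F : Filter ℕ} {e : ℕ → X} (h : IsFilterBasis F e) (n : ℕ) (x : X) : X :=
  ∑ k ∈ Finset.range (n + 1), h.coord k x • e k

/-- All partial sum maps `S_n` are continuous linear operators, and `‖S_n‖ = a n` for all `n`. -/
def HasPartialSumNorms {X : Type*} [NormedAddCommGroup X] [NormedSpace ℝ X]
    {F : Filter ℕ} {e : ℕ → X} (h : IsFilterBasis F e) (a : ℕ → ℝ) : Prop :=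
  ∀ n, ∃ S : X →L[ℝ] X, (∀ x, S x = h.partialSumMap n x) ∧ ‖S‖ = a n

end IsFilterBasis

/-- The summable filter of a sequence `s` of non-negative reals: `A` belongs to it if and only if
`∑_{k ∉ A} s k < ∞`. It is proper exactly when `∑ s k = ∞`; otherwise it is the improper filter
`⊥`, which is not free. -/
def summableFilter (s : ℕ → ℝ) (hs : ∀ k, 0 ≤ s k) : Filter ℕ where
  sets := {A | Summable (Set.indicator Aᶜ s)}
  univ_sets := by simp [summable_zero]
  sets_of_superset := by
    intro A B hA hAB
    refine Summable.of_nonneg_of_le (fun k => Set.indicator_nonneg (fun k _ => hs k) k)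
      (fun k => ?_) hA
    exact Set.indicator_le_indicator_of_subset (Set.compl_subset_compl.2 hAB) hs k
  inter_sets := by
    intro A B hA hB
    refine Summable.of_nonneg_of_le (fun k => Set.indicator_nonneg (fun k _ => hs k) k)
      (fun k => ?_) (Summable.add hA hB)
    have := hs k
    by_cases h1 : k ∈ A <;> by_cases h2 : k ∈ B <;> simp [Set.indicator, h1, h2, this]

namespace IsFilterBasis

variable {X Y : Type*} [NormedAddCommGroup X] [NormedSpace ℝ X]
  [NormedAddCommGroup Y] [NormedSpace ℝ Y] {F : Filter ℕ} {e : ℕ → X}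

theorem tendsto_coord (h : IsFilterBasis F e) (x : X) :
    Tendsto (seriesPartialSum e (fun k => h.coord k x)) F (𝓝 x) :=
  (h.existsUnique x).choose_spec.1

theorem coord_eq_of_tendsto (h : IsFilterBasis F e) {x : X} {c : ℕ → ℝ}
    (hc : Tendsto (seriesPartialSum e c) F (𝓝 x)) (k : ℕ) : h.coord k x = c k :=
  congrFun ((h.existsUnique x).unique (h.tendsto_coord x) hc) k

theorem tendsto_partialSumMap (h : IsFilterBasis F e) (x : X) :
    Tendsto (fun n => h.partialSumMap n x) F (𝓝 x) :=
  h.tendsto_coord x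

/-- A sequence with a biorthogonal sequence of continuous functionals is an `F`-basis as soon as
the associated expansions converge. -/
theorem of_biorthogonal (hF : IsFreeFilter F) (g : ℕ → X →L[ℝ] ℝ)
    (hg : ∀ j k, g j (e k) = if j = k then 1 else 0)
    (hconv : ∀ x, Tendsto (seriesPartialSum e (fun k => g k x)) F (𝓝 x)) :
    IsFilterBasis F e := by
  refine ⟨hF, fun x => ⟨fun k => g k x, hconv x, fun c hc => ?_⟩⟩
  have := hF.neBot
  ext k
  have h1 : Tendsto (fun n => g k (seriesPartialSum e c n)) F (𝓝 (g k x)) :=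
    ((g k).continuous.tendsto x).comp hc
  have h2 : ∀ᶠ n in F, g k (seriesPartialSum e c n) = c k := by
    refine hF.le_cofinite ?_
    rw [Nat.cofinite_eq_atTop]
    filter_upwards [eventually_ge_atTop k] with n hn
    simp [seriesPartialSum, hg, Nat.lt_succ_of_le hn]
  exact tendsto_nhds_unique (tendsto_const_nhds.congr' (h2.mono fun _ h => h.symm)) h1

theorem map_seriesPartialSum (L : X ≃ₗᵢ[ℝ] Y) (c : ℕ → ℝ) (n : ℕ) :
    seriesPartialSum (fun k => L (e k)) c n = L (seriesPartialSum e c n) := by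
  simp [seriesPartialSum, map_sum]

theorem map_tendsto_iff (L : X ≃ₗᵢ[ℝ] Y) (c : ℕ → ℝ) (y : Y) :
    Tendsto (seriesPartialSum (fun k => L (e k)) c) F (𝓝 y) ↔
      Tendsto (seriesPartialSum e c) F (𝓝 (L.symm y)) := by
  rw [show seriesPartialSum (fun k => L (e k)) c = L ∘ seriesPartialSum e c from
    funext (map_seriesPartialSum L c)]
  constructor
  · intro h
    simpa [Function.comp_def] using (L.symm.continuous.tendsto y).comp h
  · intro h
    simpa using (L.continuous.tendsto _).comp h

theorem map (h : IsFilterBasis F e) (L : X ≃ₗᵢ[ℝ] Y) :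
    IsFilterBasis F (fun k => L (e k)) :=
  ⟨h.free, fun y => by simpa only [map_tendsto_iff] using h.existsUnique (L.symm y)⟩

theorem HasPartialSumNorms.map {h : IsFilterBasis F e} {a : ℕ → ℝ} (ha : h.HasPartialSumNorms a)
    (L : X ≃ₗᵢ[ℝ] Y) : (h.map L).HasPartialSumNorms a := by
  intro n
  obtain ⟨S, hS, hn⟩ := ha n
  refine ⟨(L : X →L[ℝ] Y) ∘L S ∘L (L.symm : Y →L[ℝ] X), fun y => ?_, ?_⟩
  · have hc : ∀ k, (h.map L).coord k y = h.coord k (L.symm y) := fun k =>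
      (h.map L).coord_eq_of_tendsto ((map_tendsto_iff L _ y).2 (h.tendsto_coord _)) k
    simp [hS, partialSumMap, hc, map_sum]
  · rw [← hn]
    refine le_antisymm ?_ ?_
    · refine ContinuousLinearMap.opNorm_le_bound _ (norm_nonneg _) fun y => ?_
      simpa using S.le_opNorm (L.symm y)
    · refine ContinuousLinearMap.opNorm_le_bound _ (norm_nonneg _) fun x => ?_
      simpa using ((L : X →L[ℝ] Y) ∘L S ∘L (L.symm : Y →L[ℝ] X)).le_opNorm (L x)

end IsFilterBasis

theorem isFreeFilter_summableFilter {s : ℕ → ℝ} (hs : ∀ k, 0 ≤ s k) (h : ¬ Summable s) :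
    IsFreeFilter (summableFilter s hs) := by
  refine ⟨⟨fun hbot => h ?_⟩, fun A hA => ?_⟩
  · have : (∅ : Set ℕ) ∈ summableFilter s hs := by rw [hbot]; exact mem_bot
    change Summable (Set.indicator (∅ : Set ℕ)ᶜ s) at this
    simpa using this
  · change Summable (Set.indicator Aᶜ s)
    exact summable_of_hasFiniteSupport ((mem_cofinite.1 hA).subset Set.support_indicator_subset)

/-- The space `ℓ₁` of absolutely summable real sequences. -/
local notation "ℓone" => lp (fun _ : ℕ => ℝ) 1

namespace ellOne

theorem hasSum_abs (x : ℓone) : HasSum (fun k => |x k|) ‖x‖ := by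
  simpa using lp.hasSum_norm (p := 1) (by simp) x

theorem summable_abs (x : ℓone) : Summable (fun k => |x k|) := (hasSum_abs x).summable

/-- The `k`-th unit vector of `ℓ₁`. -/
noncomputable def unit (k : ℕ) : ℓone := lp.single 1 k (1 : ℝ)

theorem unit_apply (k j : ℕ) : unit k j = if j = k then 1 else 0 := by
  simp [unit, lp.single_apply, Pi.single_apply]

theorem norm_unit (k : ℕ) : ‖unit k‖ = 1 := by
  simp [unit, lp.norm_single]

/-- Truncation to the coordinates `0, …, n - 1`. -/
noncomputable def trunc (n : ℕ) (x : ℓone) : ℓone := ∑ k ∈ Finset.range n, x k • unit k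

theorem norm_trunc_le (n : ℕ) (x : ℓone) : ‖trunc n x‖ ≤ ∑ k ∈ Finset.range n, |x k| := by
  refine (norm_sum_le _ _).trans (Finset.sum_le_sum fun k _ => ?_)
  simp [norm_smul, norm_unit]

theorem tendsto_trunc (x : ℓone) : Tendsto (fun n => trunc n x) atTop (𝓝 x) := by
  have h := (lp.hasSum_single (p := 1) (by simp) x).tendsto_sum_nat
  refine h.congr fun n => Finset.sum_congr rfl fun k _ => ?_
  rw [unit, ← lp.single_smul]
  simp

/-- The `k`-th coordinate functional of `ℓ₁`. -/
noncomputable def eval (k : ℕ) : ℓone →L[ℝ] ℝ := lp.evalCLM ℝ (fun _ : ℕ => ℝ) 1 k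

@[simp] theorem eval_apply (k : ℕ) (x : ℓone) : eval k x = x k := rfl

variable (a : ℕ → ℝ)

/-- The basis vectors: `f₀ = e₀` and `(1 + aₙ) fₙ₊₁ = eₙ₊₁ - aₙ fₙ`. -/
noncomputable def vec : ℕ → ℓone
  | 0 => unit 0
  | n + 1 => (1 + a n)⁻¹ • (unit (n + 1) - a n • vec n)

/-- The functionals biorthogonal to `vec`. -/
noncomputable def dual : ℕ → ℓone →L[ℝ] ℝ
  | 0 => eval 0 + a 0 • eval 1
  | n + 1 => (1 + a n) • eval (n + 1) + a (n + 1) • eval (n + 2)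

variable {a}

theorem vec_succ_apply (n j : ℕ) :
    vec a (n + 1) j = (1 + a n)⁻¹ * (unit (n + 1) j - a n * vec a n j) := by
  change eval j (vec a (n + 1)) = _
  rw [vec, map_smul, map_sub, map_smul]
  rfl

theorem vec_apply_of_lt (n : ℕ) : ∀ j, n < j → vec a n j = 0 := by
  induction n with
  | zero => intro j hj; simp [vec, unit_apply, hj.ne']
  | succ n ih =>
    intro j hj
    simp [vec_succ_apply, unit_apply, hj.ne', ih j (by omega)]

theorem vec_succ_apply_self (n : ℕ) : vec a (n + 1) (n + 1) = (1 + a n)⁻¹ := by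
  simp [vec_succ_apply, unit_apply, vec_apply_of_lt]

theorem sum_dual_smul_vec (ha : ∀ n, 1 < a n) (x : ℓone) (n : ℕ) :
    seriesPartialSum (vec a) (fun k => dual a k x) n =
      trunc (n + 1) x + (a n * x (n + 1)) • vec a n := by
  unfold seriesPartialSum trunc
  induction n with
  | zero => simp [dual, vec, add_smul]
  | succ n ih =>
    have h0 : 1 + a n ≠ 0 := by linarith [ha n]
    rw [Finset.sum_range_succ, ih, Finset.sum_range_succ (fun k => x k • unit k) (n + 1)]
    have h1 : x (n + 1) • unit (n + 1) =
        (x (n + 1) * (1 + a n)) • vec a (n + 1) + (a n * x (n + 1)) • vec a n := by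
      simp only [vec, smul_smul, mul_assoc, mul_inv_cancel₀ h0, mul_one]
      rw [smul_sub, smul_smul, mul_comm (a n)]
      abel
    have h2 : dual a (n + 1) x = x (n + 1) * (1 + a n) + a (n + 1) * x (n + 2) := by
      simp [dual, mul_comm]
    rw [h1]
    beta_reduce
    rw [h2, add_smul]
    abel

theorem dual_unit_of_lt {j k : ℕ} (h : j + 1 < k) : dual a j (unit k) = 0 := by
  cases j with
  | zero =>
    have h1 : 0 ≠ k := by omega
    have h2 : 1 ≠ k := by omega
    simp [dual, unit_apply, h1, h2]
  | succ j =>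
    have h1 : j + 1 ≠ k := by omega
    have h2 : j + 2 ≠ k := by omega
    simp [dual, unit_apply, h1, h2]

theorem dual_unit_succ (j : ℕ) : dual a j (unit (j + 1)) = a j := by
  cases j <;> simp [dual, unit_apply]

theorem dual_vec_of_lt {j k : ℕ} (h : k < j) : dual a j (vec a k) = 0 := by
  cases j with
  | zero => omega
  | succ j => simp [dual, vec_apply_of_lt k _ h, vec_apply_of_lt k (j + 2) (by omega)]

theorem dual_vec_self (ha : ∀ n, 1 < a n) (k : ℕ) : dual a k (vec a k) = 1 := by
  cases k with
  | zero => simp [dual, vec, unit_apply]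
  | succ k =>
    have h0 : 1 + a k ≠ 0 := by linarith [ha k]
    have h2 : vec a (k + 1) (k + 2) = 0 := vec_apply_of_lt _ _ (by omega)
    simp [dual, vec_succ_apply_self, h2, h0]

theorem dual_vec (ha : ∀ n, 1 < a n) (j k : ℕ) :
    dual a j (vec a k) = if j = k then 1 else 0 := by
  rcases lt_trichotomy k j with h | rfl | h
  · rw [dual_vec_of_lt h, if_neg h.ne']
  · rw [dual_vec_self ha, if_pos rfl]
  · rw [if_neg h.ne]
    obtain ⟨d, rfl⟩ := Nat.exists_eq_add_of_lt h
    induction d with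
    | zero =>
      simp only [vec, map_smul, map_sub, dual_vec_self ha, dual_unit_succ]
      simp
    | succ d ih =>
      have h1 := ih (by omega)
      have h2 : dual a j (unit (j + d + 1 + 1)) = 0 := dual_unit_of_lt (by omega)
      rw [show j + (d + 1) + 1 = j + d + 1 + 1 by omega, vec, map_smul, map_sub, map_smul, h1, h2]
      simp

theorem norm_vec_le (ha : ∀ n, 1 < a n) (n : ℕ) : ‖vec a n‖ ≤ 1 := by
  induction n with
  | zero => simp [vec, norm_unit]
  | succ n ih =>
    have h0 : 0 < 1 + a n := by linarith [ha n]
    rw [vec, norm_smul, norm_inv, Real.norm_of_nonneg h0.le, inv_mul_le_iff₀ h0]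
    refine (norm_sub_le _ _).trans ?_
    rw [norm_unit, norm_smul, Real.norm_of_nonneg (by linarith [ha n])]
    nlinarith [ha n]

/-- The alternating sum of the coordinates up to `M`. -/
noncomputable def alt (M : ℕ) : ℓone →L[ℝ] ℝ := ∑ k ∈ Finset.range (M + 1), (-1 : ℝ) ^ k • eval k

theorem abs_alt_le (M : ℕ) (x : ℓone) : |alt M x| ≤ ‖x‖ := by
  have : alt M x = ∑ k ∈ Finset.range (M + 1), (-1 : ℝ) ^ k * x k := by simp [alt]
  rw [this]
  refine (Finset.abs_sum_le_sum_abs _ _).trans ?_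
  simp only [abs_mul, abs_pow, abs_neg, abs_one, one_pow, one_mul]
  exact sum_le_hasSum _ (fun _ _ => abs_nonneg _) (hasSum_abs x)

theorem alt_unit {M k : ℕ} (h : k ≤ M) : alt M (unit k) = (-1) ^ k := by
  simp [alt, unit_apply, Nat.lt_succ_of_le h]

theorem alt_vec (ha : ∀ n, 1 < a n) {M n : ℕ} (h : n ≤ M) : alt M (vec a n) = (-1) ^ n := by
  induction n with
  | zero => simp [vec, alt_unit]
  | succ n ih =>
    have h0 : 1 + a n ≠ 0 := by linarith [ha n]
    rw [vec, map_smul, map_sub, map_smul, ih (by omega), alt_unit h]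
    simp only [smul_eq_mul]
    field_simp
    ring

theorem norm_vec (ha : ∀ n, 1 < a n) (n : ℕ) : ‖vec a n‖ = 1 := by
  refine le_antisymm (norm_vec_le ha n) ?_
  have h := abs_alt_le n (vec a n)
  rw [alt_vec ha le_rfl] at h
  simpa using h

theorem tendsto_vec_expansion (ha : ∀ n, 1 < a n) (hs : ∀ n, 0 ≤ (a n)⁻¹)
    (hfree : IsFreeFilter (summableFilter (fun n => (a n)⁻¹) hs)) (x : ℓone) :
    Tendsto (seriesPartialSum (vec a) (fun k => dual a k x))
      (summableFilter (fun n => (a n)⁻¹) hs) (𝓝 x) := by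
  rw [show seriesPartialSum (vec a) (fun k => dual a k x) = _ from
    funext (sum_dual_smul_vec ha x)]
  have h1 : Tendsto (fun n => trunc (n + 1) x) (summableFilter (fun n => (a n)⁻¹) hs) (𝓝 x) := by
    refine Tendsto.mono_left ((tendsto_add_atTop_iff_nat 1).2 (tendsto_trunc x)) ?_
    rw [← Nat.cofinite_eq_atTop]
    exact hfree.le_cofinite
  suffices h2 : Tendsto (fun n => (a n * x (n + 1)) • vec a n)
      (summableFilter (fun n => (a n)⁻¹) hs) (𝓝 0) by simpa using h1.add h2
  rw [Metric.tendsto_nhds]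
  intro ε hε
  change Summable (Set.indicator {n | dist _ (0 : ℓone) < ε}ᶜ fun n => (a n)⁻¹)
  have hsum : Summable fun n => ε⁻¹ * |x (n + 1)| :=
    ((summable_nat_add_iff 1).2 (summable_abs x)).mul_left _
  refine Summable.of_nonneg_of_le (fun n => Set.indicator_nonneg (fun k _ => hs k) n)
    (fun n => ?_) hsum
  refine Set.indicator_apply_le' (fun hn => ?_) (fun _ => by positivity)
  have h0 : 0 < a n := by linarith [ha n]
  simp only [dist_zero_right, norm_smul, norm_vec ha, Set.mem_compl_iff, Set.mem_ofPred_eq,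
    not_lt, mul_one, Real.norm_eq_abs, abs_mul, abs_of_pos h0] at hn
  rw [inv_mul_eq_div, le_div_iff₀ hε, inv_mul_le_iff₀ h0]
  exact hn

theorem exists_basis (ha : ∀ n, 1 < a n) (hs : ∀ n, 0 ≤ (a n)⁻¹)
    (hdiv : ¬ Summable fun n => (a n)⁻¹) :
    ∃ (e : ℕ → ℓone) (h : IsFilterBasis (summableFilter (fun n => (a n)⁻¹) hs) e),
      h.HasPartialSumNorms a := by
  have hfree := isFreeFilter_summableFilter hs hdiv
  have hconv := tendsto_vec_expansion ha hs hfree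
  have hb := IsFilterBasis.of_biorthogonal hfree (dual a) (dual_vec ha) hconv
  refine ⟨vec a, hb, fun n => ⟨∑ k ∈ Finset.range (n + 1), (dual a k).smulRight (vec a k),
    fun x => ?_, ?_⟩⟩
  · simp [IsFilterBasis.partialSumMap, hb.coord_eq_of_tendsto (hconv x)]
  · have hS : ∀ x, (∑ k ∈ Finset.range (n + 1), (dual a k).smulRight (vec a k)) x =
        trunc (n + 1) x + (a n * x (n + 1)) • vec a n := fun x => by
      rw [← sum_dual_smul_vec ha x n]
      simp [seriesPartialSum]
    have h0 : 0 < a n := by linarith [ha n]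
    refine le_antisymm (ContinuousLinearMap.opNorm_le_bound _ h0.le fun x => ?_) ?_
    · rw [hS]
      refine (norm_add_le _ _).trans ?_
      have h1 := norm_trunc_le (n + 1) x
      have h2 := sum_le_hasSum (Finset.range (n + 2)) (fun _ _ => abs_nonneg _) (hasSum_abs x)
      rw [Finset.sum_range_succ] at h2
      have h3 : 0 ≤ ∑ k ∈ Finset.range (n + 1), |x k| :=
        Finset.sum_nonneg fun _ _ => abs_nonneg _
      rw [norm_smul, norm_vec ha, mul_one, norm_mul, Real.norm_of_nonneg h0.le, Real.norm_eq_abs]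
      nlinarith [ha n]
    · have h := (∑ k ∈ Finset.range (n + 1), (dual a k).smulRight (vec a k)).le_opNorm
        (unit (n + 1))
      have ht : trunc (n + 1) (unit (n + 1)) = 0 := by
        refine Finset.sum_eq_zero fun k hk => ?_
        have : k ≠ n + 1 := by have := Finset.mem_range.1 hk; omega
        simp [unit_apply, this]
      rw [hS, ht, unit_apply, if_pos rfl, norm_unit, zero_add, norm_smul, norm_vec ha] at h
      simpa [abs_of_pos h0] using h

theorem not_finiteDimensional : ¬ FiniteDimensional ℝ ℓone := by
  intro h
  have hli : LinearIndependent ℝ unit := by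
    rw [linearIndependent_iff']
    intro s c hc k hk
    have := congrArg (eval k) hc
    simpa [unit_apply, hk] using this
  exact not_finite_iff_infinite.2 inferInstance hli.finite_of_isNoetherian

end ellOne

theorem circleAverage_log_norm_one_add_mul {b : ℂ} {r : ℝ} (hr : 0 < r)
    (hb : ∀ z : ℂ, ‖z‖ = r → 1 + z * b ≠ 0) :
    Real.circleAverage (fun z : ℂ => Real.log ‖1 + z * b‖) 0 r = Real.posLog (r * ‖b‖) := by
  rcases eq_or_ne b 0 with rfl | h0
  · simp [Real.circleAverage_const]
  have hb0 : 0 < ‖b‖ := norm_pos_iff.2 h0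
  have h1 : Real.circleAverage (fun z : ℂ => Real.log ‖1 + z * b‖) 0 r =
      Real.circleAverage ((fun _ => Real.log ‖b‖) + fun z => Real.log ‖z - (-b⁻¹)‖) 0 r := by
    refine Real.circleAverage_congr_sphere fun z hz => ?_
    have hz' : ‖z‖ = r := by simpa [abs_of_pos hr] using hz
    have h2 : 1 + z * b = b * (z - (-b⁻¹)) := by field_simp; ring
    have h3 : z - (-b⁻¹) ≠ 0 := fun h => hb z hz' (by rw [h2, h, mul_zero])
    simp only [Pi.add_apply]
    rw [h2, norm_mul, Real.log_mul hb0.ne' (norm_ne_zero_iff.2 h3)]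
  rw [h1, Real.circleAverage_add (circleIntegrable_const _ _ _)
    (circleIntegrable_log_norm_sub_const r), Real.circleAverage_const,
    circleAverage_log_norm_sub_const_eq_log_radius_add_posLog hr.ne']
  have h4 := Real.posLog_sub_posLog_inv (x := r * ‖b‖)
  rw [Real.log_mul hr.ne' hb0.ne', mul_inv] at h4
  simp only [zero_sub, neg_neg, norm_inv]
  linarith

theorem mul_log_le_of_forall_sum_log_le {ι : Type*} [Fintype ι] {w : ι → ℝ} (hw : ∀ k, 0 ≤ w k)
    {b : ι → ℂ} {r M : ℝ} (hr : 0 < r) (hb : ∀ k, ∀ z : ℂ, ‖z‖ = r → 1 + z * b k ≠ 0)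
    (hM : ∀ z : ℂ, ‖z‖ = r → ∑ k, w k * Real.log ‖1 + z * b k‖ ≤ M) (i : ι) :
    w i * Real.log (r * ‖b i‖) ≤ M := by
  have hci : ∀ k, CircleIntegrable (fun z : ℂ => w k • Real.log ‖1 + z * b k‖) 0 r := fun k =>
    IntervalIntegrable.const_mul (MeromorphicOn.circleIntegrable_log_norm
      (f := fun z => 1 + z * b k) fun z _ => by fun_prop) (w k)
  have h1 : Real.circleAverage (fun z : ℂ => ∑ k, w k • Real.log ‖1 + z * b k‖) 0 r ≤ M :=
    Real.circleAverage_mono_on_of_le_circle (CircleIntegrable.fun_sum _ fun k _ => hci k)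
      fun z hz => hM z (by simpa [abs_of_pos hr] using hz)
  rw [Real.circleAverage_fun_sum fun k _ => hci k] at h1
  simp only [Real.circleAverage_fun_smul] at h1
  simp only [circleAverage_log_norm_one_add_mul hr (hb _), smul_eq_mul] at h1
  calc w i * Real.log (r * ‖b i‖) ≤ w i * Real.posLog (r * ‖b i‖) :=
        mul_le_mul_of_nonneg_left (le_max_right _ _) (hw i)
    _ ≤ ∑ k, w k * Real.posLog (r * ‖b k‖) :=
        Finset.single_le_sum (f := fun k => w k * Real.posLog (r * ‖b k‖))
          (fun k _ => mul_nonneg (hw k) Real.posLog_nonneg) (Finset.mem_univ i)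
    _ ≤ M := h1

/-- A plank theorem for finite-dimensional complex normed spaces, up to a constant factor. -/
theorem exists_forall_mul_norm_le_of_sum_le_one {ι V : Type*} [Fintype ι] [NormedAddCommGroup V]
    [NormedSpace ℂ V] [FiniteDimensional ℂ V] (φ : ι → V →L[ℂ] ℂ) (hφ : ∀ i, ∃ x, φ i x ≠ 0)
    {w : ι → ℝ} (hw : ∀ i, 0 < w i) (hw1 : ∑ i, w i ≤ 1) :
    ∃ x : V, ‖x‖ ≤ 1 ∧ ∀ i, ∀ y, ‖y‖ ≤ 1 → w i * ‖φ i y‖ ≤ 8 * ‖φ i x‖ := by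
  have : ProperSpace V := FiniteDimensional.proper ℂ V
  set G : V → ℝ := fun x => ∏ i, ‖φ i x‖ ^ w i with hG
  have hGc : Continuous G := continuous_finsetProd _ fun i _ =>
    ((φ i).continuous.norm).rpow_const fun _ => Or.inr (hw i).le
  obtain ⟨x, hx, hmax⟩ := (isCompact_closedBall (0 : V) 1).exists_isMaxOn
    ⟨0, by simp⟩ hGc.continuousOn
  obtain ⟨z, hz⟩ := Module.Dual.exists_forall_ne_zero_of_forall_exists
    (fun i => (φ i : V →ₗ[ℂ] ℂ)) hφ
  have hx1 : ‖x‖ ≤ 1 := by simpa using hx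
  have hpos : 0 < G x := by
    have hz1 : 0 < max 1 ‖z‖ := by positivity
    set c : ℂ := ((max 1 ‖z‖ : ℝ) : ℂ)⁻¹
    have hc : c ≠ 0 := inv_ne_zero (by exact_mod_cast hz1.ne')
    refine lt_of_lt_of_le ?_ (hmax (show c • z ∈ Metric.closedBall (0 : V) 1 from ?_))
    · refine Finset.prod_pos fun i _ => Real.rpow_pos_of_pos (norm_pos_iff.2 ?_) _
      rw [map_smul]
      exact smul_ne_zero hc (hz i)
    · rw [mem_closedBall_zero_iff, norm_smul, norm_inv, Complex.norm_real,
        Real.norm_of_nonneg hz1.le, inv_mul_le_iff₀ hz1, mul_one]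
      exact le_max_right _ _
  have hne : ∀ i, φ i x ≠ 0 := fun i h => by
    refine hpos.ne' (Finset.prod_eq_zero (Finset.mem_univ i) ?_)
    rw [h, norm_zero, Real.zero_rpow (hw i).ne']
  refine ⟨x, hx1, fun i y hy => ?_⟩
  set b : ι → ℂ := fun k => φ k y / φ k x with hbdef
  obtain ⟨r, ⟨hr1, hr2⟩, hrb⟩ : ∃ r ∈ Set.Ioo (w i) (2 * w i), r ∉ Set.range fun k => ‖b k‖⁻¹ :=
    ((Set.Ioo_infinite (by linarith [hw i])).sdiff (Set.finite_range _)).nonempty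
  have hr : 0 < r := (hw i).trans hr1
  have hb : ∀ k, ∀ z : ℂ, ‖z‖ = r → 1 + z * b k ≠ 0 := by
    intro k z hz h
    refine hrb ⟨k, ?_⟩
    have h1 : ‖z * b k‖ = 1 := by
      rw [show z * b k = -1 by linear_combination h]; simp
    rw [norm_mul, hz] at h1
    exact (eq_inv_of_mul_eq_one_left h1).symm
  have hM : ∀ z : ℂ, ‖z‖ = r → ∑ k, w k * Real.log ‖1 + z * b k‖ ≤ r := by
    intro z hz
    have hr0 : (0 : ℝ) < 1 + r := by linarith
    set c : ℂ := ((1 + r : ℝ) : ℂ)⁻¹ with hc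
    have hcn : ‖c‖ = (1 + r)⁻¹ := by
      rw [hc, norm_inv, Complex.norm_real, Real.norm_of_nonneg hr0.le]
    have hmem : c • (x + z • y) ∈ Metric.closedBall (0 : V) 1 := by
      rw [mem_closedBall_zero_iff, norm_smul, hcn, inv_mul_le_iff₀ hr0, mul_one]
      refine (norm_add_le _ _).trans (add_le_add hx1 ?_)
      rw [norm_smul, hz]
      exact mul_le_of_le_one_right hr.le hy
    have hval : ∀ k, ‖φ k (c • (x + z • y))‖ = ((1 + r)⁻¹ * ‖φ k x‖) * ‖1 + z * b k‖ := by
      intro k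
      rw [← hcn, ← norm_mul, ← norm_mul, map_smul, map_add, map_smul]
      congr 1
      simp only [hbdef, smul_eq_mul]
      field_simp [hne k]
    have h1 := Real.log_le_log (Finset.prod_pos fun k _ => Real.rpow_pos_of_pos (by
      rw [hval]
      have := norm_pos_iff.2 (hne k)
      have := norm_pos_iff.2 (hb k z hz)
      positivity) _) (hmax hmem)
    rw [Real.log_prod, Real.log_prod] at h1
    · have h2 : ∀ k, Real.log (‖φ k (c • (x + z • y))‖ ^ w k) =
          Real.log (‖φ k x‖ ^ w k) + (w k * Real.log ‖1 + z * b k‖ - w k * Real.log (1 + r)) := by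
        intro k
        have h3 := norm_pos_iff.2 (hne k)
        have h4 := norm_pos_iff.2 (hb k z hz)
        rw [hval, Real.log_rpow (by positivity), Real.log_rpow h3,
          Real.log_mul (by positivity) h4.ne', Real.log_mul (by positivity) h3.ne', Real.log_inv]
        ring
      simp only [h2, Finset.sum_add_distrib, Finset.sum_sub_distrib, ← Finset.sum_mul] at h1
      have h5 : Real.log (1 + r) ≤ r := by linarith [Real.log_le_sub_one_of_pos hr0]
      have h6 : 0 ≤ Real.log (1 + r) := Real.log_nonneg (by linarith)
      nlinarith
    · intro k _
      exact (Real.rpow_pos_of_pos (norm_pos_iff.2 (hne k)) _).ne'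
    · intro k _
      refine (Real.rpow_pos_of_pos ?_ _).ne'
      rw [hval]
      have := norm_pos_iff.2 (hne k)
      have := norm_pos_iff.2 (hb k z hz)
      positivity
  have hlog := mul_log_le_of_forall_sum_log_le (fun k => (hw k).le) hr hb hM i
  have hbi : w i * ‖b i‖ ≤ 8 := by
    by_cases h0 : ‖b i‖ = 0
    · rw [h0]; norm_num
    have h0' : 0 < ‖b i‖ := lt_of_le_of_ne (norm_nonneg _) (Ne.symm h0)
    have h1 : Real.log (r * ‖b i‖) ≤ 2 := by
      by_contra! h
      nlinarith [hw i]
    have h2 : r * ‖b i‖ ≤ Real.exp 2 := (Real.log_le_iff_le_exp (by positivity)).1 h1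
    have h3 : Real.exp 2 ≤ 8 := by
      have h4 : Real.exp 2 = Real.exp 1 * Real.exp 1 := by rw [← Real.exp_add]; norm_num
      rw [h4]
      nlinarith [Real.exp_one_lt_d9, Real.exp_pos 1]
    nlinarith
  have hn := norm_pos_iff.2 (hne i)
  rw [hbdef] at hbi
  simp only [norm_div] at hbi
  rwa [← mul_div_assoc, div_le_iff₀ hn] at hbi

theorem exists_forall_lt_mul_norm_le (B : ℕ → ℕ → ℂ) (hB : ∀ i, B i i ≠ 0) {w : ℕ → ℝ}
    (hw : ∀ i, 0 < w i) (n : ℕ) (hw1 : ∑ i ∈ Finset.range n, w i ≤ 1) :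
    ∃ s : ℕ → ℂ, (∀ m, ∑ j ∈ Finset.range m, ‖s j‖ ≤ 1) ∧
      ∀ i < n, w i * ‖B i i‖ ≤ 8 * ‖∑' j, B i j * s j‖ := by
  let V := PiLp 1 (fun _ : Fin n => ℂ)
  let φ : Fin n → V →L[ℂ] ℂ := fun i => ∑ j : Fin n, B i j • PiLp.proj 1 (fun _ : Fin n => ℂ) j
  have hφ : ∀ i (s : V), φ i s = ∑ j : Fin n, B i j * s j := fun i s => by
    simp [φ]
    rfl
  let e : Fin n → V := fun i => PiLp.single 1 i (1 : ℂ)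
  have he : ∀ i, ‖e i‖ ≤ 1 := fun i =>
    ((PiLp.norm_single 1 (fun _ : Fin n => ℂ) i 1).trans norm_one).le
  have hφe : ∀ i, φ i (e i) = B i i := fun i => by simp [hφ, e]
  obtain ⟨x, hx1, hx⟩ := exists_forall_mul_norm_le_of_sum_le_one φ
    (fun i => ⟨e i, by rw [hφe]; exact hB i⟩) (w := fun i => w i) (fun i => hw i)
    (by rwa [Fin.sum_univ_eq_sum_range])
  let s : ℕ → ℂ := fun j => if h : j < n then x ⟨j, h⟩ else 0
  have hs : ∀ i : Fin n, s i = x i := fun i => by simp [s]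
  have hs0 : ∀ j, j ∉ Finset.range n → s j = 0 := fun j hj => by
    have : ¬ j < n := by simpa using hj
    simp [s, this]
  refine ⟨s, fun m => ?_, fun i hi => ?_⟩
  · have h1 : HasSum (fun j => ‖s j‖) (∑ j ∈ Finset.range n, ‖s j‖) :=
      hasSum_sum_of_ne_finset_zero fun j hj => by rw [hs0 j hj, norm_zero]
    refine (sum_le_hasSum _ (fun _ _ => norm_nonneg _) h1).trans ?_
    rw [← Fin.sum_univ_eq_sum_range (fun j => ‖s j‖)]
    simp only [hs]
    rwa [← PiLp.norm_eq_of_L1]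
  · have h1 := hx ⟨i, hi⟩ (e ⟨i, hi⟩) (he _)
    rw [hφe, hφ] at h1
    rw [tsum_eq_sum (s := Finset.range n) fun j hj => by rw [hs0 j hj, mul_zero],
      ← Fin.sum_univ_eq_sum_range (fun j => B i j * s j)]
    simpa only [hs] using h1

theorem summable_norm_of_sum_le_one {s : ℕ → ℂ} (hs : ∀ m, ∑ j ∈ Finset.range m, ‖s j‖ ≤ 1) :
    Summable fun j => ‖s j‖ :=
  summable_of_sum_range_le (fun _ => norm_nonneg _) hs

theorem exists_norm_le_of_tendsto_zero {b : ℕ → ℂ} (hb : Tendsto b atTop (𝓝 0)) :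
    ∃ M, ∀ j, ‖b j‖ ≤ M := by
  obtain ⟨M, hM⟩ := hb.norm.bddAbove_range
  exact ⟨M, fun j => hM ⟨j, rfl⟩⟩

theorem summable_mul_of_tendsto_zero {b s : ℕ → ℂ} (hb : Tendsto b atTop (𝓝 0))
    (hs : ∀ m, ∑ j ∈ Finset.range m, ‖s j‖ ≤ 1) : Summable fun j => ‖b j * s j‖ := by
  obtain ⟨M, hM⟩ := exists_norm_le_of_tendsto_zero hb
  refine Summable.of_nonneg_of_le (fun _ => norm_nonneg _) (fun j => ?_)
    ((summable_norm_of_sum_le_one hs).mul_left M)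
  rw [norm_mul]
  exact mul_le_mul_of_nonneg_right (hM j) (norm_nonneg _)

/-- Elements of `c₀` act continuously on the unit ball of `ℓ₁` with pointwise convergence. -/
theorem tendsto_tsum_mul_of_tendsto_pointwise {b : ℕ → ℂ} (hb : Tendsto b atTop (𝓝 0))
    {t : ℕ → ℕ → ℂ} {s : ℕ → ℂ} (ht : ∀ n m, ∑ j ∈ Finset.range m, ‖t n j‖ ≤ 1)
    (hs : ∀ m, ∑ j ∈ Finset.range m, ‖s j‖ ≤ 1)
    (hts : ∀ j, Tendsto (fun n => t n j) atTop (𝓝 (s j))) :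
    Tendsto (fun n => ∑' j, b j * t n j) atTop (𝓝 (∑' j, b j * s j)) := by
  refine Metric.tendsto_atTop.2 fun ε hε => ?_
  obtain ⟨J, hJ⟩ : ∃ J, ∀ j ≥ J, ‖b j‖ ≤ ε / 4 := by
    obtain ⟨J, hJ⟩ := Metric.tendsto_atTop.1 hb (ε / 4) (by linarith)
    exact ⟨J, fun j hj => by simpa using (hJ j hj).le⟩
  have hfin : Tendsto (fun n => ∑ j ∈ Finset.range J, b j * t n j) atTop
      (𝓝 (∑ j ∈ Finset.range J, b j * s j)) :=
    tendsto_finsetSum _ fun j _ => (hts j).const_mul _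
  have htail : ∀ u : ℕ → ℂ, (∀ m, ∑ j ∈ Finset.range m, ‖u j‖ ≤ 1) →
      ‖∑' j, b (j + J) * u (j + J)‖ ≤ ε / 4 := by
    intro u hu
    have h1 := summable_norm_of_sum_le_one hu
    have h2 : ∑' j, ‖u (j + J)‖ ≤ 1 := by
      have h3 := h1.sum_add_tsum_nat_add J
      have h4 : ∑' j, ‖u j‖ ≤ 1 := Real.tsum_le_of_sum_range_le (fun _ => norm_nonneg _) hu
      have h5 : 0 ≤ ∑ j ∈ Finset.range J, ‖u j‖ := Finset.sum_nonneg fun _ _ => norm_nonneg _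
      linarith
    have h6 := ((summable_nat_add_iff J).2 h1).hasSum.mul_left (ε / 4)
    refine (tsum_of_norm_bounded h6 fun j => ?_).trans (by nlinarith)
    rw [norm_mul]
    exact mul_le_mul_of_nonneg_right (hJ _ (by omega)) (norm_nonneg _)
  obtain ⟨N, hN⟩ := Metric.tendsto_atTop.1 hfin (ε / 2) (by linarith)
  refine ⟨N, fun n hn => ?_⟩
  have h1 := hN n hn
  rw [dist_eq_norm] at h1 ⊢
  rw [← (summable_mul_of_tendsto_zero hb (ht n)).of_norm.sum_add_tsum_nat_add J,
    ← (summable_mul_of_tendsto_zero hb hs).of_norm.sum_add_tsum_nat_add J, add_sub_add_comm]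
  have h2 := htail _ (ht n)
  have h3 := htail _ hs
  have h4 := norm_add_le
    (∑ j ∈ Finset.range J, b j * t n j - ∑ j ∈ Finset.range J, b j * s j)
    (∑' j, b (j + J) * t n (j + J) - ∑' j, b (j + J) * s (j + J))
  have h5 := norm_sub_le (∑' j, b (j + J) * t n (j + J)) (∑' j, b (j + J) * s (j + J))
  linarith

/-- A countable complex plank theorem for functionals in `c₀` on the unit ball of `ℓ₁`. -/
theorem exists_forall_mul_norm_le (B : ℕ → ℕ → ℂ) (hB : ∀ i, B i i ≠ 0)
    (hB0 : ∀ i, Tendsto (B i) atTop (𝓝 0)) {w : ℕ → ℝ}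
    (hw : ∀ i, 0 < w i) (hw1 : ∀ n, ∑ i ∈ Finset.range n, w i ≤ 1) :
    ∃ s : ℕ → ℂ, (∀ m, ∑ j ∈ Finset.range m, ‖s j‖ ≤ 1) ∧
      ∀ i, w i * ‖B i i‖ ≤ 8 * ‖∑' j, B i j * s j‖ := by
  choose t ht1 ht using fun n => exists_forall_lt_mul_norm_le B hB hw n (hw1 n)
  have hmem : ∀ n, t n ∈ Set.pi Set.univ fun _ : ℕ => Metric.closedBall (0 : ℂ) 1 := by
    intro n j _
    rw [mem_closedBall_zero_iff]
    exact (Finset.single_le_sum (f := fun j => ‖t n j‖) (fun _ _ => norm_nonneg _)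
      (Finset.self_mem_range_succ j)).trans (ht1 n (j + 1))
  obtain ⟨s, -, θ, hθ, hlim⟩ :=
    (isCompact_univ_pi fun _ : ℕ => isCompact_closedBall (0 : ℂ) 1).tendsto_subseq hmem
  have hpt : ∀ j, Tendsto (fun n => t (θ n) j) atTop (𝓝 (s j)) := tendsto_pi_nhds.1 hlim
  have hs : ∀ m, ∑ j ∈ Finset.range m, ‖s j‖ ≤ 1 := fun m =>
    le_of_tendsto (tendsto_finsetSum _ fun j _ => (hpt j).norm)
      (Eventually.of_forall fun n => ht1 (θ n) m)
  refine ⟨s, hs, fun i => ?_⟩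
  have h1 := tendsto_tsum_mul_of_tendsto_pointwise (hB0 i) (fun n => ht1 (θ n)) hs hpt
  refine ge_of_tendsto (h1.norm.const_mul 8) ?_
  filter_upwards [eventually_gt_atTop i] with n hn
  exact ht (θ n) i (hn.trans_le (hθ.id_le n))

theorem exists_tendsto_zero_sum_div_le {u : ℕ → ℝ} (hu : ∀ n, 0 < u n) (hs : Summable u) {δ : ℝ}
    (hδ : 0 < δ) :
    ∃ (N : ℕ) (σ : ℕ → ℝ), (∀ i, 0 < σ i) ∧ (∀ i, σ i ≤ 1) ∧ Tendsto σ atTop (𝓝 0) ∧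
      ∀ n, ∑ i ∈ Finset.range n, u (i + N) / σ i ≤ δ := by
  set T : ℕ → ℝ := fun n => ∑' k, u (k + n) with hT
  have hTsucc : ∀ n, T n = u n + T (n + 1) := fun n => by
    have h := ((summable_nat_add_iff n).2 hs).tsum_eq_zero_add
    simp only [zero_add] at h
    simp only [hT, h]
    congr 2
    ext k
    congr 1
    omega
  have hTnn : ∀ n, 0 ≤ T n := fun n => tsum_nonneg fun k => (hu _).le
  have hTpos : ∀ n, 0 < T n := fun n => by linarith [hTsucc n, hTnn (n + 1), hu n]
  have hanti : Antitone T := antitone_nat_of_succ_le fun n => by linarith [hTsucc n, hu n]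
  have hlim : Tendsto (fun n => √(T n)) atTop (𝓝 0) := by
    simpa [Function.comp_def] using (Real.continuous_sqrt.tendsto 0).comp (tendsto_sum_nat_add u)
  have hstep : ∀ n, u n / √(T n) ≤ 2 * (√(T n) - √(T (n + 1))) := fun n => by
    have h1 := Real.sqrt_pos.2 (hTpos n)
    have h2 := Real.sqrt_nonneg (T (n + 1))
    rw [div_le_iff₀ h1]
    have h3 := Real.sq_sqrt (hTnn n)
    have h4 := Real.sq_sqrt (hTnn (n + 1))
    nlinarith [sq_nonneg (√(T n) - √(T (n + 1))), hTsucc n]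
  obtain ⟨N, hN⟩ := (hlim.eventually_lt_const (lt_min one_pos (half_pos hδ))).exists
  rw [lt_min_iff] at hN
  refine ⟨N, fun i => √(T (i + N)), fun i => Real.sqrt_pos.2 (hTpos _), fun i => ?_,
    (tendsto_add_atTop_iff_nat N).2 hlim, fun n => ?_⟩
  · exact (Real.sqrt_le_sqrt (hanti (by omega))).trans hN.1.le
  · have h : ∑ i ∈ Finset.range n, u (i + N) / √(T (i + N)) ≤
        2 * (√(T N) - √(T (n + N))) := by
      induction n with
      | zero => simp
      | succ n ih =>
        rw [Finset.sum_range_succ]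
        have := hstep (n + N)
        rw [show n + 1 + N = n + N + 1 by omega]
        linarith
    linarith [Real.sqrt_nonneg (T (n + N))]

/-- If the inverses of the norms of a sequence of operators on a Banach space are summable, then
the orbits of two suitable vectors of the unit ball are eventually nowhere simultaneously small. -/
theorem exists_forall_five_le_norm_add_norm {X : Type*} [NormedAddCommGroup X] [NormedSpace ℝ X]
    [CompleteSpace X] (S : ℕ → X →L[ℝ] X) (hpos : ∀ n, 0 < ‖S n‖)
    (hsum : Summable fun n => ‖S n‖⁻¹) :
    ∃ (N : ℕ) (x y : X), ‖x‖ ≤ 1 ∧ ‖y‖ ≤ 1 ∧ ∀ n ≥ N, 5 ≤ ‖S n x‖ + ‖S n y‖ := by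
  obtain ⟨N, σ, hσ0, hσ1, hσ, hσs⟩ := exists_tendsto_zero_sum_div_le
    (fun n => inv_pos.2 (hpos n)) hsum (δ := 1 / 80) (by norm_num)
  have hv : ∀ n, ∃ v : X, ‖v‖ < 1 ∧ ‖S n‖ / 2 < ‖S n v‖ := fun n =>
    (S n).exists_lt_apply_of_lt_opNorm (half_lt_self (hpos n))
  choose v hv1 hv2 using hv
  have hg : ∀ n, ∃ g : X →L[ℝ] ℝ, ‖g‖ ≤ 1 ∧ g (S n (v n)) = ‖S n (v n)‖ := fun n =>
    exists_dual_vector'' ℝ _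
  choose g hg1 hg2 using hg
  have hgle : ∀ n z, |g n z| ≤ ‖z‖ := fun n z =>
    ((g n).le_opNorm z).trans (mul_le_of_le_one_left (norm_nonneg _) (hg1 n))
  set A : ℕ → ℕ → ℝ := fun i j => g (i + N) (S (i + N) (v (j + N))) with hA
  have hAle : ∀ i j, |A i j| ≤ ‖S (i + N)‖ := fun i j =>
    (hgle _ _).trans (((S _).le_opNorm _).trans
      (mul_le_of_le_one_right (norm_nonneg _) (hv1 _).le))
  have hAii : ∀ i, ‖S (i + N)‖ / 2 < A i i := fun i => by
    simp only [hA, hg2]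
    exact hv2 _
  have hAB : ∀ i, 0 < A i i * σ i := fun i =>
    mul_pos ((half_pos (hpos _)).trans (hAii i)) (hσ0 i)
  obtain ⟨s, hs1, hs⟩ := exists_forall_mul_norm_le (fun i j => ((A i j * σ j : ℝ) : ℂ))
    (fun i => Complex.ofReal_ne_zero.2 (hAB i).ne')
    (fun i => by
      rw [← Complex.ofReal_zero]
      refine (Complex.continuous_ofReal.tendsto 0).comp ?_
      refine squeeze_zero_norm (fun j => ?_) (by simpa using hσ.const_mul ‖S (i + N)‖)
      rw [norm_mul, Real.norm_of_nonneg (hσ0 j).le]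
      exact mul_le_mul_of_nonneg_right (hAle i j) (hσ0 j).le)
    (w := fun i => 80 * (‖S (i + N)‖⁻¹ / σ i))
    (fun i => mul_pos (by norm_num) (div_pos (inv_pos.2 (hpos _)) (hσ0 i)))
    (fun n => by
      rw [← Finset.mul_sum]
      linarith [hσs n])
  have hsn : Summable fun j => ‖s j‖ := summable_norm_of_sum_le_one hs1
  have hsn1 : ∑' j, ‖s j‖ ≤ 1 := Real.tsum_le_of_sum_range_le (fun _ => norm_nonneg _) hs1
  have key : ∀ c : ℕ → ℝ, (∀ j, |c j| ≤ ‖s j‖) →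
      ∃ x : X, ‖x‖ ≤ 1 ∧ HasSum (fun j => (c j * σ j) • v (j + N)) x := by
    intro c hc
    have hb : ∀ j, ‖(c j * σ j) • v (j + N)‖ ≤ ‖s j‖ := fun j => by
      rw [norm_smul, norm_mul, Real.norm_of_nonneg (hσ0 j).le, Real.norm_eq_abs]
      refine (mul_le_of_le_one_right (mul_nonneg (abs_nonneg _) (hσ0 j).le) (hv1 _).le).trans ?_
      exact (mul_le_of_le_one_right (abs_nonneg _) (hσ1 j)).trans (hc j)
    exact ⟨_, (tsum_of_norm_bounded hsn.hasSum hb).trans hsn1,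
      (Summable.of_norm_bounded hsn hb).hasSum⟩
  obtain ⟨x, hx1, hx⟩ := key (fun j => (s j).re) fun j => Complex.abs_re_le_norm _
  obtain ⟨y, hy1, hy⟩ := key (fun j => (s j).im) fun j => Complex.abs_im_le_norm _
  refine ⟨N, x, y, hx1, hy1, fun n hn => ?_⟩
  obtain ⟨i, rfl⟩ : ∃ i, n = i + N := ⟨n - N, by omega⟩
  have hmap : ∀ (c : ℕ → ℝ) (z : X), HasSum (fun j => (c j * σ j) • v (j + N)) z →
      HasSum (fun j => ((A i j * σ j * c j : ℝ) : ℂ)) (g (i + N) (S (i + N) z) : ℝ) := by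
    intro c z hz
    refine Complex.hasSum_ofReal.2 ?_
    refine (((g (i + N)).comp (S (i + N))).hasSum hz).congr_fun fun j => ?_
    simp only [hA, ContinuousLinearMap.comp_apply, map_smul, smul_eq_mul]
    ring
  have htot : HasSum (fun j => ((A i j * σ j : ℝ) : ℂ) * s j)
      ((g (i + N) (S (i + N) x) : ℝ) + (g (i + N) (S (i + N) y) : ℝ) * Complex.I) := by
    convert! (hmap _ x hx).add ((hmap _ y hy).mul_right Complex.I) using 2 with j
    nth_rewrite 1 [← Complex.re_add_im (s j)]
    push_cast
    ring
  have h1 := hs i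
  rw [htot.tsum_eq, Complex.norm_real, Real.norm_of_nonneg (hAB i).le] at h1
  have h2 : 40 ≤ 80 * (‖S (i + N)‖⁻¹ / σ i) * (A i i * σ i) := by
    have hσi := hσ0 i
    have hSi := hpos (i + N)
    have : 80 * (‖S (i + N)‖⁻¹ / σ i) * (A i i * σ i) = 80 * (A i i / ‖S (i + N)‖) := by
      field_simp
    rw [this]
    have : 1 / 2 ≤ A i i / ‖S (i + N)‖ := by
      rw [le_div_iff₀ hSi]
      linarith [hAii i]
    linarith
  have h3 := norm_add_le (g (i + N) (S (i + N) x) : ℂ)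
    ((g (i + N) (S (i + N) y) : ℝ) * Complex.I)
  rw [norm_mul, Complex.norm_I, mul_one, Complex.norm_real, Complex.norm_real] at h3
  have h4 := hgle (i + N) (S (i + N) x)
  have h5 := hgle (i + N) (S (i + N) y)
  rw [Real.norm_eq_abs, Real.norm_eq_abs] at h3
  linarith

theorem IsFilterBasis.HasPartialSumNorms.not_summable_inv {X : Type*} [NormedAddCommGroup X]
    [NormedSpace ℝ X] [CompleteSpace X] {F : Filter ℕ} {e : ℕ → X} {h : IsFilterBasis F e}
    {a : ℕ → ℝ} (hn : h.HasPartialSumNorms a) (ha : ∀ n, 0 < a n) :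
    ¬ Summable fun n => (a n)⁻¹ := by
  intro hsum
  choose S hS hSn using hn
  obtain ⟨N, x, y, hx, hy, hxy⟩ := exists_forall_five_le_norm_add_norm S
    (fun n => by rw [hSn]; exact ha n) (by simpa only [hSn] using hsum)
  have := h.free.neBot
  have hlim : ∀ z, Tendsto (fun n => ‖S n z‖) F (𝓝 ‖z‖) := fun z => by
    simpa only [hS] using (h.tendsto_partialSumMap z).norm
  have hev : ∀ᶠ n in F, N ≤ n := by
    refine h.free.le_cofinite ?_
    rw [Nat.cofinite_eq_atTop]
    exact eventually_ge_atTop N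
  have h5 : 5 ≤ ‖x‖ + ‖y‖ := ge_of_tendsto ((hlim x).add (hlim y)) (hev.mono hxy)
  linarith

theorem mainTheorem1 (a : ℕ → ℝ) (ha : ∀ n, 1 < a n) :
    List.TFAE [
      Tendsto (fun N => ∑ n ∈ Finset.range N, (a n)⁻¹) atTop atTop,
      ∃ F : Filter ℕ, IsFreeFilter F ∧
        ∃ (X : Type u) (_ : NormedAddCommGroup X) (_ : NormedSpace ℝ X),
          CompleteSpace X ∧ ¬ FiniteDimensional ℝ X ∧
          ∃ (e : ℕ → X) (h : IsFilterBasis F e), h.HasPartialSumNorms a,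
      ∃ (e : ℕ → lp (fun _ : ℕ => ℝ) 1)
        (h : IsFilterBasis
          (summableFilter (fun n => (a n)⁻¹)
            (fun n => inv_nonneg.2 (zero_le_one.trans (ha n).le))) e),
        h.HasPartialSumNorms a] := by
  have hs : ∀ n, 0 ≤ (a n)⁻¹ := fun n => inv_nonneg.2 (zero_le_one.trans (ha n).le)
  have hdiv := not_summable_iff_tendsto_nat_atTop_of_nonneg hs
  tfae_have 1 → 3 := fun h => ellOne.exists_basis ha hs (hdiv.2 h)
  tfae_have 3 → 2 := by
    rintro ⟨e, h, hn⟩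
    let L : lp (fun _ : ℕ => ℝ) 1 ≃ₗᵢ[ℝ] ULift.{u} (lp (fun _ : ℕ => ℝ) 1) :=
      (LinearIsometryEquiv.ulift ℝ (lp (fun _ : ℕ => ℝ) 1)).symm
    refine ⟨_, h.free, ULift.{u} (lp (fun _ : ℕ => ℝ) 1), inferInstance, inferInstance,
      
      ULift.instCompleteSpace, fun hfin => ?_, _, h.map L, hn.map L⟩
    exact ellOne.not_finiteDimensional
      (LinearEquiv.finiteDimensional L.symm.toLinearEquiv)
  tfae_have 2 → 1 := by
    rintro ⟨F, -, X, _, _, _, -, e, h, hn⟩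
    exact hdiv.1 (hn.not_summable_inv fun n => zero_lt_one.trans (ha n))
  tfae_finish
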